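/- Consider the stable marriage problem with a set $M$ of $n$ men and a set $W$ of $n$ women ($n \ge 1$), where every agent has a strict total order over the agents of the other side. For a profile $\succ$, let $\mathrm{DA}(\succ)$ be the matching computed by men-proposing deferred acceptance. Fix a man $m$ (the accomplice), let $\mu = \mathrm{DA}(\succ)$, and for $X \subseteq W$ let $\mu^X$ be the matching computed by deferred acceptance when $m$ instead reports the list obtained from his true list by moving the women of $X$ (other than $\mu(m)$) who stand below $\mu(m)$ to positions above $\mu(m)$, while all other agents report truthfully. Let $W^{\mathrm{NR}}$ be the set of all $w \in W$ such that $m$ does not find $\mu^{\{w\}}(m)$ worse than $\mu(m)$. A set $Y \subseteq W^{\mathrm{NR}}$ is a minimum no-regret push-up set if $\mu^Y = \mu^{W^{\mathrm{NR}}}$ and no $Z \subseteq W^{\mathrm{NR}}$ with $\mu^Z = \mu^{W^{\mathrm{NR}}}$ satisfies $|Z| < |Y|$. Every minimum no-regret push-up set $Y$ (for every such instance and every accomplice) satisfies $$|Y| \le \left\lfloor \frac{n-1}{2} \right\rfloor .$$ This bound is tight: for every $n \ge 1$ there are an instance with $n$ men and $n$ women, an accomplice, and a minimum no-regret push-up set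 $Y$ with $|Y| = \lfloor (n-1)/2 \rfloor$. -/

import Mathlib

/-- An instance of the stable marriage problem: equally many men and women, each agent having a
strict total order over the agents of the other side. `man m w w'` says that `m` prefers `w` to
`w'`; `woman w m m'` says that `w` prefers `m` to `m'`. -/
structure Market (M W : Type*) [Fintype M] [Fintype W] where
  card_eq : Fintype.card M = Fintype.card W
  man : M → W → W → Prop
  woman : W → M → M → Prop
  man_order : ∀ m, IsStrictTotalOrder W (man m)
  woman_order : ∀ w, IsStrictTotalOrder M (woman w)

namespace Market

variable {M W : Type*} [Fintype M] [Fintype W]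

/-- When `R` is the set of rejections so far, `w` is the favorite woman of `m` among those who have
not rejected him: the woman to whom `m` proposes, or to whom he is tentatively matched. -/
def Target (P : Market M W) (R : Set (M × W)) (m : M) (w : W) : Prop :=
  (m, w) ∉ R ∧ ∀ w', w' ≠ w → (m, w') ∉ R → P.man m w w'

/-- One round of deferred acceptance. Every woman tentatively keeps her favorite among the men
whose proposals she currently has (the man she already holds and the new proposers), and rejects
the others. -/
def round (P : Market M W) (R : Set (M × W)) : Set (M × W) :=
  R ∪ {p | P.Target R p.1 p.2 ∧ ∃ m', P.Target R m' p.2 ∧ P.woman p.2 m' p.1}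

/-- The rejections made in the first `k` rounds. -/
def rejections (P : Market M W) (k : ℕ) : Set (M × W) :=
  P.round^[k] ∅

/-- All rejections made during the execution. As there are finitely many pairs, this is the state
after finitely many rounds, when no further proposals can be made. -/
def finalRejections (P : Market M W) : Set (M × W) :=
  ⋃ k, P.rejections k

theorem rejections_succ (P : Market M W) (k : ℕ) :
    P.rejections (k + 1) = P.round (P.rejections k) :=
  Function.iterate_succ_apply' _ _ _

theorem rejections_mono (P : Market M W) : Monotone P.rejections :=
  monotone_nat_of_le_succ fun k => by
    rw [rejections_succ]
    exact Set.subset_union_left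

theorem exists_rejections_eq_final (P : Market M W) :
    ∃ k, P.rejections k = P.finalRejections ∧ P.round P.finalRejections = P.finalRejections := by
  obtain ⟨k, hk⟩ := WellFoundedGT.monotone_chain_condition
    (⟨P.rejections, P.rejections_mono⟩ : ℕ →o Set (M × W))
  have h : P.rejections k = P.finalRejections := by
    refine Set.Subset.antisymm (Set.subset_iUnion P.rejections k) (Set.iUnion_subset fun j => ?_)
    rcases le_total k j with hj | hj
    · exact (hk j hj).ge
    · exact P.rejections_mono hj
  refine ⟨k, h, ?_⟩
  rw [← h, ← rejections_succ]
  exact (hk (k + 1) k.le_succ).symm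

theorem exists_best {α : Type*} [Finite α] (r : α → α → Prop) [IsStrictTotalOrder α r]
    {S : Set α} (hS : S.Nonempty) : ∃ a ∈ S, ∀ b, b ≠ a → b ∈ S → r a b := by
  obtain ⟨a, ha, h⟩ := (Finite.wellFounded_of_trans_of_irrefl r).has_min S hS
  refine ⟨a, ha, fun b hb hbS => ?_⟩
  rcases trichotomous_of r a b with h1 | h1 | h1
  · exact h1
  · exact absurd h1.symm hb
  · exact absurd h1 (h b hbS)

/-- A woman who has rejected somebody holds a proposal. -/
theorem exists_target_of_rejected (P : Market M W) (k : ℕ) :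
    ∀ m w, (m, w) ∈ P.rejections k → ∃ m', P.Target (P.rejections k) m' w := by
  induction k with
  | zero => intro m w h; exact absurd h (Set.notMem_empty _)
  | succ k ih =>
    intro m w h
    have hne : {m' | P.Target (P.rejections k) m' w}.Nonempty := by
      rw [rejections_succ] at h
      rcases h with h | ⟨h, -⟩
      · exact ih m w h
      · exact ⟨m, h⟩
    have := P.woman_order w
    obtain ⟨a, ha, hbest⟩ := exists_best (P.woman w) hne
    refine ⟨a, ?_, fun w' hw' hn => ha.2 w' hw' fun hr =>
      hn (P.rejections_mono k.le_succ hr)⟩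
    rw [rejections_succ]
    rintro (hr | ⟨-, m', hm', hlt⟩)
    · exact ha.1 hr
    · have hne' : m' ≠ a := by
        rintro rfl
        exact irrefl_of (P.woman w) _ hlt
      exact asymm_of (P.woman w) hlt (hbest m' hne' hm')

theorem Target.unique {P : Market M W} {R : Set (M × W)} {m : M} {w w' : W}
    (h : P.Target R m w) (h' : P.Target R m w') : w = w' := by
  by_contra hne
  have := P.man_order m
  exact asymm_of (P.man m) (h.2 w' (Ne.symm hne) h'.1) (h'.2 w hne h.1)

/-- When deferred acceptance stops, every man is matched. -/
theorem exists_partner (P : Market M W) (m : M) : ∃ w, P.Target P.finalRejections m w := by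
  obtain ⟨k, hk, -⟩ := P.exists_rejections_eq_final
  rw [← hk]
  by_cases hS : {w | (m, w) ∉ P.rejections k}.Nonempty
  · have := P.man_order m
    obtain ⟨w, hw, hb⟩ := exists_best (P.man m) hS
    exact ⟨w, hw, hb⟩
  · have hall : ∀ w, (m, w) ∈ P.rejections k := by
      intro w
      by_contra hw
      exact hS ⟨w, hw⟩
    choose f hf using fun w => P.exists_target_of_rejected k m w (hall w)
    have hinj : Function.Injective f := fun w w' h => (hf w).unique (h ▸ hf w')
    have hsurj := ((Fintype.bijective_iff_injective_and_card f).2 ⟨hinj, P.card_eq.symm⟩).2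
    obtain ⟨w, hw⟩ := hsurj m
    exact absurd (hall w) (hw ▸ (hf w).1)

/-- The matching computed by men-proposing deferred acceptance, as the map that sends each man to
his partner. -/
noncomputable def DA (P : Market M W) (m : M) : W :=
  (P.exists_partner m).choose

theorem target_DA (P : Market M W) (m : M) : P.Target P.finalRejections m (P.DA m) :=
  (P.exists_partner m).choose_spec

/-- The outcome of deferred acceptance is a matching: every woman has exactly one partner. -/
theorem DA_bijective (P : Market M W) : Function.Bijective P.DA := by
  refine (Fintype.bijective_iff_injective_and_card _).2 ⟨fun a b hab => ?_, P.card_eq⟩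
  by_contra hne
  obtain ⟨-, -, hfix⟩ := P.exists_rejections_eq_final
  have ha := P.target_DA a
  have hb := P.target_DA b
  rw [← hab] at hb
  have := P.woman_order (P.DA a)
  rcases trichotomous_of (P.woman (P.DA a)) a b with h | h | h
  · exact hb.1 (hfix ▸ Or.inr ⟨hb, a, ha, h⟩)
  · exact hne h
  · exact ha.1 (hfix ▸ Or.inr ⟨ha, b, hb, h⟩)

open scoped Classical in
/-- The block of `m`'s list in which `w` stands after `m` pushes up `X`: block 2 is the part above
his partner `DA P m`, block 1 is the partner herself, and block 0 is the part below. -/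
noncomputable def pushUpBlock (P : Market M W) (m : M) (X : Finset W) (w : W) : ℕ :=
  if w = P.DA m then 1 else if P.man m w (P.DA m) ∨ w ∈ X then 2 else 0

/-- The list of `m` after he pushes up `X`: the women of `X` are moved above `DA P m`, and inside
each block the true order is kept. -/
def pushUpList (P : Market M W) (m : M) (X : Finset W) (w w' : W) : Prop :=
  P.pushUpBlock m X w' < P.pushUpBlock m X w ∨
    P.pushUpBlock m X w = P.pushUpBlock m X w' ∧ P.man m w w'

theorem pushUpList_order (P : Market M W) (m : M) (X : Finset W) :
    IsStrictTotalOrder W (P.pushUpList m X) := by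
  have := P.man_order m
  refine { irrefl := ?_, trans := ?_, trichotomous := ?_ }
  · intro a b hab hba
    simp only [pushUpList, not_or, not_and, not_lt] at hab hba
    have he : P.pushUpBlock m X a = P.pushUpBlock m X b := le_antisymm hab.1 hba.1
    rcases trichotomous_of (P.man m) a b with h | h | h
    · exact absurd h (hab.2 he)
    · exact h
    · exact absurd h (hba.2 he.symm)
  · rintro a (h | ⟨-, h⟩)
    · exact lt_irrefl _ h
    · exact irrefl_of (P.man m) _ h
  · rintro a b c (h | ⟨h, h'⟩) (k | ⟨k, k'⟩)
    · exact Or.inl (k.trans h)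
    · exact Or.inl (k ▸ h)
    · exact Or.inl (h ▸ k)
    · exact Or.inr ⟨h.trans k, trans_of (P.man m) h' k'⟩

open scoped Classical in
/-- The profile in which `m` reports the list obtained from his true list by pushing up `X`, and
everybody else is truthful. -/
noncomputable def pushUp (P : Market M W) (m : M) (X : Finset W) : Market M W where
  card_eq := P.card_eq
  man := Function.update P.man m (P.pushUpList m X)
  woman := P.woman
  man_order := fun m' => by
    by_cases h : m' = m
    · subst h
      rw [Function.update_self]
      exact P.pushUpList_order m' X
    · rw [Function.update_of_ne h]
      exact P.man_order m'
  woman_order := P.woman_order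

/-- Pushing up `X` is no-regret for `m`: his partner does not get worse, by his true list. -/
def NoRegret (P : Market M W) (m : M) (X : Finset W) : Prop :=
  P.man m ((P.pushUp m X).DA m) (P.DA m) ∨ (P.pushUp m X).DA m = P.DA m

open scoped Classical in
/-- The no-regret set: the women whom `m` can push up individually without regret. -/
noncomputable def noRegretSet (P : Market M W) (m : M) : Finset W :=
  Finset.univ.filter fun w => P.NoRegret m {w}

/-- `Y` is a minimum no-regret push-up set for the accomplice `m`. -/
def IsMinimumNoRegretPushUpSet (P : Market M W) (m : M) (Y : Finset W) : Prop :=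
  Y ⊆ P.noRegretSet m ∧
    (P.pushUp m Y).DA = (P.pushUp m (P.noRegretSet m)).DA ∧
    ¬ ∃ Z : Finset W, Z ⊆ P.noRegretSet m ∧
      (P.pushUp m Z).DA = (P.pushUp m (P.noRegretSet m)).DA ∧ Z.card < Y.card

end Market

/-! A no-regret push-up of `X` leaves `m` his partner, and its outcome is the man-optimal one among
the stable matchings of the true market that keep `m`'s partner and in which every woman of `X`
prefers her partner to `m` (unless he is her partner). Giving every man the worse of two partners
preserves stability and merges the constraints for `X` and `Y` into the one for `X ∪ Y`. Hence after
pushing up `X ∪ Y` each man has his partner from `X` or from `Y` (`DA_pushUp_union`).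

Upper bound: if `Y` is minimum, dropping any `y` changes the matching, so at least two men move, and
`m` never does. For `y ≠ z` these sets of men are disjoint, because `Y` is the union of `Y.erase y`
and `Y.erase z`. So `2 * Y.card ≤ n - 1`.

Tightness: besides the accomplice, take disjoint pairs who can swap partners. In each pair, one
woman must be pushed up to trigger the swap, and she affects no other pair (`swapMarket_subset`). -/

namespace Market

variable {M W : Type*} [Fintype M] [Fintype W]

/-! ### Stability and man-optimality of deferred acceptance. -/

theorem man_irrefl (P : Market M W) (a : M) (w : W) : ¬ P.man a w w :=
  have := P.man_order a
  irrefl_of (P.man a) w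

theorem man_asymm (P : Market M W) {a : M} {w w' : W} (h : P.man a w w') : ¬ P.man a w' w :=
  have := P.man_order a
  asymm_of (P.man a) h

theorem man_trans (P : Market M W) {a : M} {u v w : W} (h : P.man a u v) (h' : P.man a v w) :
    P.man a u w :=
  have := P.man_order a
  trans_of (P.man a) h h'

theorem man_total (P : Market M W) (a : M) (w w' : W) :
    P.man a w w' ∨ w = w' ∨ P.man a w' w :=
  have := P.man_order a
  trichotomous_of (P.man a) w w'

theorem woman_irrefl (P : Market M W) (w : W) (a : M) : ¬ P.woman w a a :=
  have := P.woman_order w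
  irrefl_of (P.woman w) a

theorem woman_asymm (P : Market M W) {w : W} {a b : M} (h : P.woman w a b) : ¬ P.woman w b a :=
  have := P.woman_order w
  asymm_of (P.woman w) h

theorem woman_trans (P : Market M W) {w : W} {a b c : M} (h : P.woman w a b)
    (h' : P.woman w b c) : P.woman w a c :=
  have := P.woman_order w
  trans_of (P.woman w) h h'

theorem woman_total (P : Market M W) (w : W) (a b : M) :
    P.woman w a b ∨ a = b ∨ P.woman w b a :=
  have := P.woman_order w
  trichotomous_of (P.woman w) a b

/-- A stable matching: whenever `a` prefers the partner of `b` to his own, she prefers `b`. -/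
def Stable (P : Market M W) (f : M → W) : Prop :=
  Function.Bijective f ∧ ∀ a b, P.man a (f b) (f a) → P.woman (f b) b a

/-- Consider the first man `a` rejected by his partner `f a`, in favor of some `b`. Since `f b` has
not yet rejected `b`, he prefers `f a` to `f b`, so `b` and `f a` block `f`. -/
theorem Stable.notMem_rejections {P : Market M W} {f : M → W} (hf : P.Stable f) (k : ℕ) :
    ∀ a, (a, f a) ∉ P.rejections k := by
  induction k with
  | zero => intro a; exact Set.notMem_empty _
  | succ k ih =>
    intro a h
    rw [rejections_succ] at h
    rcases h with h | ⟨-, b, hb, hlt⟩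
    · exact ih a h
    · by_cases hab : b = a
      · subst hab
        exact P.woman_irrefl _ _ hlt
      · exact P.woman_asymm hlt
          (hf.2 b a (hb.2 (f b) (fun h => hab (hf.1.1 h)) (ih b)))

/-- Deferred acceptance is optimal for the men among the stable matchings. -/
theorem Stable.DA_weakly_better {P : Market M W} {f : M → W} (hf : P.Stable f) (a : M) :
    P.man a (P.DA a) (f a) ∨ P.DA a = f a := by
  by_cases h : f a = P.DA a
  · exact Or.inr h.symm
  · refine Or.inl ((P.target_DA a).2 _ h fun hr => ?_)
    obtain ⟨k, hk⟩ := Set.mem_iUnion.1 hr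
    exact hf.notMem_rejections k a hk

/-- A woman's best current proposer survives the round, so what she holds only improves. -/
theorem exists_better_target_of_rejected (P : Market M W) (k : ℕ) :
    ∀ a w, (a, w) ∈ P.rejections k →
      ∃ b, P.Target (P.rejections k) b w ∧ P.woman w b a := by
  induction k with
  | zero => intro a w h; exact absurd h (Set.notMem_empty _)
  | succ k ih =>
    intro a w h
    have hne : ∃ b, P.Target (P.rejections k) b w ∧ P.woman w b a := by
      rw [rejections_succ] at h
      rcases h with h | ⟨-, h⟩
      · exact ih a w h
      · exact h
    obtain ⟨c, hc, hca⟩ := hne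
    have := P.woman_order w
    obtain ⟨b, hb, hbest⟩ := exists_best (P.woman w)
      (S := {b | P.Target (P.rejections k) b w}) ⟨c, hc⟩
    refine ⟨b, ⟨?_, fun w' hw' hn => hb.2 w' hw' fun hr =>
      hn (P.rejections_mono k.le_succ hr)⟩, ?_⟩
    · rw [rejections_succ]
      rintro (hr | ⟨-, d, hd, hlt⟩)
      · exact hb.1 hr
      · refine P.woman_asymm hlt (hbest d ?_ hd)
        rintro rfl
        exact P.woman_irrefl _ _ hlt
    · by_cases hcb : c = b
      · exact hcb ▸ hca
      · exact P.woman_trans (hbest c hcb hc) hca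

theorem stable_DA (P : Market M W) : P.Stable P.DA := by
  refine ⟨P.DA_bijective, fun a b h => ?_⟩
  have hr : (a, P.DA b) ∈ P.finalRejections := by
    by_contra hn
    have hne : P.DA b ≠ P.DA a := fun he => P.man_irrefl a (P.DA a) (he ▸ h)
    exact P.man_asymm h ((P.target_DA a).2 _ hne hn)
  obtain ⟨k, hk, -⟩ := P.exists_rejections_eq_final
  rw [← hk] at hr
  obtain ⟨c, hc, hlt⟩ := P.exists_better_target_of_rejected k _ _ hr
  rw [hk] at hc
  rwa [P.DA_bijective.1 ((P.target_DA c).unique hc)] at hlt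

/-! ### The lattice operation on stable matchings. -/

open scoped Classical in
/-- Every man gets the worse of his partners in `f` and `g`. -/
noncomputable def worse (P : Market M W) (f g : M → W) (a : M) : W :=
  if P.man a (f a) (g a) then g a else f a

theorem worse_eq_or (P : Market M W) (f g : M → W) (a : M) :
    P.worse f g a = f a ∨ P.worse f g a = g a := by
  unfold worse
  split_ifs
  · exact Or.inr rfl
  · exact Or.inl rfl

/-- Of her two partners, the one whom `w` prefers must like his other partner at least as much as
`w`, or he and `w` would block the other matching. So `w` is his worse partner. -/
theorem Stable.exists_worse_eq {P : Market M W} {f g : M → W} (hf : P.Stable f)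
    (hg : P.Stable g) (w : W) : ∃ b, P.worse f g b = w ∧
      (∀ c, f c = w → b = c ∨ P.woman w b c) ∧ (∀ c, g c = w → b = c ∨ P.woman w b c) := by
  obtain ⟨a, rfl⟩ := hf.1.2 w
  obtain ⟨b, hb⟩ := hg.1.2 (f a)
  rcases P.woman_total (f a) a b with h | h | h
  · refine ⟨a, if_neg fun hm => ?_, fun c hc => Or.inl (hf.1.1 hc).symm, fun c hc => Or.inr ?_⟩
    · rw [← hb] at hm h
      exact P.woman_asymm h (hg.2 a b hm)
    · rwa [hg.1.1 (hc.trans hb.symm)]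
  · subst h
    refine ⟨a, ?_, fun c hc => Or.inl (hf.1.1 hc).symm,
      fun c hc => Or.inl (hg.1.1 (hc.trans hb.symm)).symm⟩
    rcases P.worse_eq_or f g a with h | h
    · exact h
    · exact h.trans hb
  · refine ⟨b, ?_, fun c hc => Or.inr ?_, fun c hc => Or.inl (hg.1.1 (hc.trans hb.symm)).symm⟩
    · rcases P.man_total b (f b) (g b) with hm | hm | hm
      · exact (if_pos hm).trans hb
      · have hba : b = a := hf.1.1 (hm.trans hb)
        subst hba
        exact absurd h (P.woman_irrefl _ _)
      · rw [hb] at hm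
        exact absurd (hf.2 b a hm) (P.woman_asymm h)
    · rwa [hf.1.1 hc]

theorem Stable.worse_bijective {P : Market M W} {f g : M → W} (hf : P.Stable f)
    (hg : P.Stable g) : Function.Bijective (P.worse f g) :=
  (Fintype.bijective_iff_surjective_and_card _).2
    ⟨fun w => (hf.exists_worse_eq hg w).imp fun _ h => h.1, P.card_eq⟩

/-- In `worse f g` every woman gets the better of her partners in `f` and `g`. -/
theorem Stable.worse_partner {P : Market M W} {f g : M → W} (hf : P.Stable f)
    (hg : P.Stable g) (b : M) :
      (∀ c, f c = P.worse f g b → b = c ∨ P.woman (P.worse f g b) b c) ∧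
        (∀ c, g c = P.worse f g b → b = c ∨ P.woman (P.worse f g b) b c) := by
  obtain ⟨b', hb', h⟩ := hf.exists_worse_eq hg (P.worse f g b)
  rwa [(hf.worse_bijective hg).1 hb'] at h

/-- A man's partner comes from `f` or `g`. A block with him would already block that matching, since
each woman is at least as well off in `worse f g`. -/
theorem Stable.worse {P : Market M W} {f g : M → W} (hf : P.Stable f) (hg : P.Stable g) :
    P.Stable (P.worse f g) := by
  refine ⟨hf.worse_bijective hg, fun a b h => ?_⟩
  obtain ⟨hbf, hbg⟩ := hf.worse_partner hg b
  rcases P.worse_eq_or f g a with ha | ha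
  · rw [ha] at h
    obtain ⟨c, hc⟩ := hf.1.2 (P.worse f g b)
    have hca : P.woman (P.worse f g b) c a := hc ▸ hf.2 a c (hc.symm ▸ h)
    rcases hbf c hc with rfl | hlt
    · exact hca
    · exact P.woman_trans hlt hca
  · rw [ha] at h
    obtain ⟨c, hc⟩ := hg.1.2 (P.worse f g b)
    have hca : P.woman (P.worse f g b) c a := hc ▸ hg.2 a c (hc.symm ▸ h)
    rcases hbg c hc with rfl | hlt
    · exact hca
    · exact P.woman_trans hlt hca

/-! ### No-regret push-ups as constrained stable matchings. -/

theorem pushUp_man_self (P : Market M W) (m : M) (X : Finset W) :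
    (P.pushUp m X).man m = P.pushUpList m X := by
  classical
  simp [pushUp]

theorem pushUp_man_of_ne (P : Market M W) {m a : M} (h : a ≠ m) (X : Finset W) :
    (P.pushUp m X).man a = P.man a := by
  classical
  simp [pushUp, h]

theorem pushUpList_partner_right (P : Market M W) (m : M) (X : Finset W) (w : W) :
    P.pushUpList m X w (P.DA m) ↔ w ≠ P.DA m ∧ (P.man m w (P.DA m) ∨ w ∈ X) := by
  have := P.man_irrefl m (P.DA m)
  by_cases h : w = P.DA m
  · subst h
    simp [pushUpList, pushUpBlock, this]
  · by_cases h' : P.man m w (P.DA m) ∨ w ∈ X <;> simp [pushUpList, pushUpBlock, h, h']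

/-- A woman weakly above the partner of `m` keeps the better women of the true list above her. -/
theorem pushUpList_of_man (P : Market M W) (m : M) (X : Finset W) {w w' : W}
    (hw : P.man m w (P.DA m) ∨ w = P.DA m) (h : P.man m w' w) : P.pushUpList m X w' w := by
  have hw' : P.man m w' (P.DA m) := by
    rcases hw with hw | rfl
    · exact P.man_trans h hw
    · exact h
  have hne' : w' ≠ P.DA m := fun he => P.man_irrefl m w' (he.symm ▸ hw')
  rcases hw with hw | rfl
  · have hne : w ≠ P.DA m := fun he => P.man_irrefl m w (he.symm ▸ hw)
    exact Or.inr ⟨by simp [pushUpBlock, hne, hne', hw, hw'], h⟩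
  · exact (P.pushUpList_partner_right m X w').2 ⟨hne', Or.inl hw'⟩

/-- A no-regret push-up leads to a stable matching, in which `m` keeps his partner. -/
theorem NoRegret.stable {P : Market M W} {m : M} {X : Finset W} (h : P.NoRegret m X) :
    P.Stable (P.pushUp m X).DA := by
  have hs := (P.pushUp m X).stable_DA
  refine ⟨hs.1, fun a b hab => hs.2 a b ?_⟩
  by_cases ha : a = m
  · subst ha
    rw [pushUp_man_self]
    exact P.pushUpList_of_man a X h hab
  · rwa [P.pushUp_man_of_ne ha]

theorem NoRegret.partner_eq {P : Market M W} {m : M} {X : Finset W} (h : P.NoRegret m X) :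
    (P.pushUp m X).DA m = P.DA m := by
  rcases h.stable.DA_weakly_better m with h' | h'
  · rcases h with h | h
    · exact absurd h (P.man_asymm h')
    · exact h
  · exact h'.symm

/-- The stable matchings in which `m` keeps his partner and each woman of `X` prefers her partner
to `m`, unless she is matched to `m`. -/
def ConstrainedStable (P : Market M W) (m : M) (X : Finset W) (f : M → W) : Prop :=
  P.Stable f ∧ f m = P.DA m ∧ ∀ b, b ≠ m → f b ∈ X → P.woman (f b) b m

theorem ConstrainedStable.mono {P : Market M W} {m : M} {X Y : Finset W} {f : M → W}
    (hf : P.ConstrainedStable m Y f) (h : X ⊆ Y) : P.ConstrainedStable m X f :=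
  ⟨hf.1, hf.2.1, fun b hb hX => hf.2.2 b hb (h hX)⟩

theorem constrainedStable_DA_empty (P : Market M W) (m : M) :
    P.ConstrainedStable m ∅ P.DA :=
  ⟨P.stable_DA, rfl, fun _ _ h => absurd h (Finset.notMem_empty _)⟩

theorem NoRegret.constrainedStable {P : Market M W} {m : M} {X : Finset W}
    (h : P.NoRegret m X) : P.ConstrainedStable m X (P.pushUp m X).DA := by
  refine ⟨h.stable, h.partner_eq, fun b hb hX => (P.pushUp m X).stable_DA.2 m b ?_⟩
  rw [pushUp_man_self, h.partner_eq, pushUpList_partner_right]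
  refine ⟨fun he => hb ?_, Or.inr hX⟩
  exact (P.pushUp m X).DA_bijective.1 (he.trans h.partner_eq.symm)

/-- Converse to `NoRegret.constrainedStable`: while `m` holds `DA P m`, the only new potential
blocks are with women of `X`, and the constraint excludes these. -/
theorem ConstrainedStable.stable_pushUp {P : Market M W} {m : M} {X : Finset W} {f : M → W}
    (hf : P.ConstrainedStable m X f) : (P.pushUp m X).Stable f := by
  refine ⟨hf.1.1, fun a b hab => ?_⟩
  by_cases ha : a = m
  · subst ha
    rw [pushUp_man_self, hf.2.1, pushUpList_partner_right] at hab
    have hb : b ≠ a := by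
      rintro rfl
      exact hab.1 hf.2.1
    rcases hab.2 with h | h
    · exact hf.1.2 a b (hf.2.1.symm ▸ h)
    · exact hf.2.2 b hb h
  · rw [P.pushUp_man_of_ne ha] at hab
    exact hf.1.2 a b hab

theorem ConstrainedStable.worse [DecidableEq W] {P : Market M W} {m : M} {X Y : Finset W}
    {f g : M → W} (hf : P.ConstrainedStable m X f) (hg : P.ConstrainedStable m Y g) :
    P.ConstrainedStable m (X ∪ Y) (P.worse f g) := by
  refine ⟨hf.1.worse hg.1, ?_, fun b hb hXY => ?_⟩
  · rcases P.worse_eq_or f g m with h | h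
    · exact h.trans hf.2.1
    · exact h.trans hg.2.1
  · obtain ⟨hbf, hbg⟩ := hf.1.worse_partner hg.1 b
    rcases Finset.mem_union.1 hXY with hX | hY
    · obtain ⟨c, hc⟩ := hf.1.1.2 (P.worse f g b)
      rcases hbf c hc with rfl | hlt
      · exact hc ▸ hf.2.2 b hb (hc.symm ▸ hX)
      · by_cases hcm : c = m
        · exact hcm ▸ hlt
        · exact P.woman_trans hlt (hc ▸ hf.2.2 c hcm (hc.symm ▸ hX))
    · obtain ⟨c, hc⟩ := hg.1.1.2 (P.worse f g b)
      rcases hbg c hc with rfl | hlt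
      · exact hc ▸ hg.2.2 b hb (hc.symm ▸ hY)
      · by_cases hcm : c = m
        · exact hcm ▸ hlt
        · exact P.woman_trans hlt (hc ▸ hg.2.2 c hcm (hc.symm ▸ hY))

theorem mem_noRegretSet {P : Market M W} {m : M} {w : W} :
    w ∈ P.noRegretSet m ↔ P.NoRegret m {w} := by
  simp [noRegretSet]

theorem exists_constrainedStable (P : Market M W) (m : M) (X : Finset W)
    (hX : X ⊆ P.noRegretSet m) : ∃ f, P.ConstrainedStable m X f := by
  classical
  induction X using Finset.induction_on with
  | empty => exact ⟨_, P.constrainedStable_DA_empty m⟩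
  | insert x X _ ih =>
    obtain ⟨f, hf⟩ := ih ((Finset.subset_insert x X).trans hX)
    have hx := (mem_noRegretSet.1 (hX (Finset.mem_insert_self x X))).constrainedStable
    exact ⟨_, Finset.insert_eq x X ▸ hx.worse hf⟩

/-- Women that can be pushed up individually without regret can be pushed up together. -/
theorem noRegret_of_subset {P : Market M W} {m : M} {X : Finset W}
    (hX : X ⊆ P.noRegretSet m) : P.NoRegret m X := by
  obtain ⟨f, hf⟩ := P.exists_constrainedStable m X hX
  rcases hf.stable_pushUp.DA_weakly_better m with h | h
  swap
  · exact Or.inr (h.trans hf.2.1)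
  rw [pushUp_man_self, hf.2.1, pushUpList_partner_right] at h
  obtain ⟨hne, h | hx⟩ := h
  · exact Or.inl h
  by_contra hreg
  set x := (P.pushUp m X).DA m with hxdef
  have hnb : ¬ P.man m x (P.DA m) := fun hb => hreg (Or.inl hb)
  -- If `m` regrets, his partner is some `x ∈ X`. Every woman above `x` in the list for `{x}` is
  -- also above `x` in the list for `X`, so the outcome stays stable when only `x` is pushed up.
  -- Optimality then contradicts that `{x}` is no-regret.
  have hs : (P.pushUp m {x}).Stable (P.pushUp m X).DA := by
    refine ⟨(P.pushUp m X).DA_bijective, fun a b hab => (P.pushUp m X).stable_DA.2 a b ?_⟩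
    by_cases ha : a = m
    · subst ha
      rw [pushUp_man_self, ← hxdef] at hab ⊢
      set w := (P.pushUp a X).DA b
      have hxb : ∀ Z : Finset W, x ∈ Z → P.pushUpBlock a Z x = 2 := fun Z hZ => by
        simp [pushUpBlock, hne, hZ]
      have hle : P.pushUpBlock a {x} w ≤ P.pushUpBlock a X w := by
        unfold pushUpBlock
        by_cases hw : w = P.DA a
        · simp [hw]
        · by_cases hwx : w = x
          · simp [hwx, hx]
          · by_cases hm : P.man a w (P.DA a) <;> simp [hw, hwx, hm]
      unfold pushUpList at hab ⊢
      rw [hxb _ hx]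
      rw [hxb _ (Finset.mem_singleton_self x)] at hab
      have hle2 : P.pushUpBlock a X w ≤ 2 := by
        unfold pushUpBlock
        split_ifs <;> omega
      rcases hab with hab | ⟨hab, hm⟩
      · exact Or.inl (by omega)
      · exact Or.inr ⟨by omega, hm⟩
    · rwa [P.pushUp_man_of_ne ha] at hab ⊢
  have hxr : P.NoRegret m {x} := mem_noRegretSet.1 (hX hx)
  rcases hs.DA_weakly_better m with h | h
  · rw [pushUp_man_self, hxr.partner_eq, ← hxdef] at h
    refine (P.pushUp m {x}).man_asymm (a := m) (w := P.DA m) (w' := x) ?_ ?_ <;>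
      rw [pushUp_man_self]
    · exact h
    · exact (P.pushUpList_partner_right m {x} x).2 ⟨hne, Or.inr (Finset.mem_singleton_self x)⟩
  · exact hne (h.symm.trans hxr.partner_eq)

theorem ConstrainedStable.DA_pushUp_weakly_better {P : Market M W} {m : M} {X : Finset W}
    {f : M → W} (hf : P.ConstrainedStable m X f) (hX : X ⊆ P.noRegretSet m) (a : M) :
    P.man a ((P.pushUp m X).DA a) (f a) ∨ (P.pushUp m X).DA a = f a := by
  by_cases ha : a = m
  · subst ha
    exact Or.inr ((noRegret_of_subset hX).partner_eq.trans hf.2.1.symm)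
  · have h := hf.stable_pushUp.DA_weakly_better a
    rwa [P.pushUp_man_of_ne ha] at h

/-- Each man's partner after pushing up `X ∪ Y` is his partner after pushing up `X` or `Y`. -/
theorem DA_pushUp_union [DecidableEq W] {P : Market M W} {m : M} {X Y : Finset W}
    (hX : X ⊆ P.noRegretSet m) (hY : Y ⊆ P.noRegretSet m) (a : M) :
    (P.pushUp m (X ∪ Y)).DA a = (P.pushUp m X).DA a ∨
      (P.pushUp m (X ∪ Y)).DA a = (P.pushUp m Y).DA a := by
  have hXY := Finset.union_subset hX hY
  have h := (noRegret_of_subset hXY).constrainedStable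
  -- By `hx` and `hy` the man does no better under `X ∪ Y` than under `X` or `Y`; by `hw` he does no
  -- worse than the worse of the two.
  have hx := (h.mono Finset.subset_union_left).DA_pushUp_weakly_better hX a
  have hy := (h.mono Finset.subset_union_right).DA_pushUp_weakly_better hY a
  have hw := ((noRegret_of_subset hX).constrainedStable.worse
    (noRegret_of_subset hY).constrainedStable).DA_pushUp_weakly_better hXY a
  rcases P.worse_eq_or (P.pushUp m X).DA (P.pushUp m Y).DA a with e | e <;> rw [e] at hw
  · rcases hw with hw | hw
    · rcases hx with hx | hx
      · exact absurd hx (P.man_asymm hw)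
      · exact Or.inl hx.symm
    · exact Or.inl hw
  · rcases hw with hw | hw
    · rcases hy with hy | hy
      · exact absurd hy (P.man_asymm hw)
      · exact Or.inr hy.symm
    · exact Or.inr hw

/-! ### The upper bound by counting displaced men. -/

/-- If `f` moves `a`, the man to whom `g` gives `f a` must move too. -/
theorem two_le_card_filter_ne {α β : Type*} [Fintype α] [DecidableEq β] {f g : α → β} (hf : f.Injective)
    (hg : g.Bijective) (hne : f ≠ g) : 2 ≤ (Finset.univ.filter fun a => f a ≠ g a).card := by
  obtain ⟨a, ha⟩ := Function.ne_iff.1 hne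
  obtain ⟨b, hb⟩ := hg.2 (f a)
  have hab : a ≠ b := by
    rintro rfl
    exact ha hb.symm
  refine Finset.one_lt_card.2 ⟨a, by simpa using ha, b, ?_, hab⟩
  simp only [Finset.mem_filter, Finset.mem_univ, true_and, hb]
  exact fun h => hab (hf h).symm

theorem IsMinimumNoRegretPushUpSet.two_mul_card_lt {P : Market M W} {m : M} {Y : Finset W}
    (hY : P.IsMinimumNoRegretPushUpSet m Y) : 2 * Y.card < Fintype.card M := by
  classical
  obtain ⟨hsub, hDA, hmin⟩ := hY
  let A : W → Finset M := fun y =>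
    Finset.univ.filter fun a => (P.pushUp m (Y.erase y)).DA a ≠ (P.pushUp m Y).DA a
  have herase : ∀ y, Y.erase y ⊆ P.noRegretSet m := fun y => (Finset.erase_subset y Y).trans hsub
  have hcard : ∀ y ∈ Y, 2 ≤ (A y).card := fun y hy =>
    two_le_card_filter_ne (Market.DA_bijective _).1 (Market.DA_bijective _) fun h =>
      hmin ⟨Y.erase y, herase y, h.trans hDA, Finset.card_erase_lt_of_mem hy⟩
  have hdisj : (Y : Set W).PairwiseDisjoint A := by
    intro y _ z _ hyz
    refine Finset.disjoint_left.2 fun a hay haz => ?_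
    have hu : Y.erase y ∪ Y.erase z = Y := by
      ext x
      simp only [Finset.mem_union, Finset.mem_erase]
      grind
    have h := DA_pushUp_union (herase y) (herase z) a
    rw [hu] at h
    rcases h with h | h
    · exact (Finset.mem_filter.1 hay).2 h.symm
    · exact (Finset.mem_filter.1 haz).2 h.symm
  have hm : Y.biUnion A ⊆ Finset.univ.erase m := by
    intro a ha
    obtain ⟨y, _, hay⟩ := Finset.mem_biUnion.1 ha
    refine Finset.mem_erase.2 ⟨?_, Finset.mem_univ a⟩
    rintro rfl
    exact (Finset.mem_filter.1 hay).2 ((noRegret_of_subset (herase y)).partner_eq.trans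
      (noRegret_of_subset hsub).partner_eq.symm)
  have h1 := Finset.card_nsmul_le_sum Y (fun y => (A y).card) 2 hcard
  have h2 := Finset.card_le_card hm
  rw [Finset.card_biUnion hdisj, Finset.card_erase_of_mem (Finset.mem_univ m),
    Finset.card_univ] at h2
  have h3 : 0 < Fintype.card M := Fintype.card_pos_iff.2 ⟨m⟩
  rw [smul_eq_mul] at h1
  omega

theorem exists_isMinimumNoRegretPushUpSet (P : Market M W) (m : M) :
    ∃ Y, P.IsMinimumNoRegretPushUpSet m Y := by
  classical
  obtain ⟨Y, hY, hmin⟩ := Finset.exists_min_image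
    ((P.noRegretSet m).powerset.filter fun Z =>
      (P.pushUp m Z).DA = (P.pushUp m (P.noRegretSet m)).DA)
    Finset.card ⟨P.noRegretSet m, by simp⟩
  simp only [Finset.mem_filter, Finset.mem_powerset] at hY hmin
  exact ⟨Y, hY.1, hY.2, fun ⟨Z, hZ, hZ', hlt⟩ => (hmin Z ⟨hZ, hZ'⟩).not_gt hlt⟩

end Market

/-! ### Tightness: a market of independent swaps. -/

/-- The order by a rank, with ties broken by a linear order. -/
theorem isStrictTotalOrder_of_rank {V : Type*} [LinearOrder V] (r : V → ℕ) :
    IsStrictTotalOrder V fun a b => r a < r b ∨ r a = r b ∧ a < b where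
  irrefl a := by simp
  trans a b c := by
    rintro (h | ⟨h, h'⟩) (k | ⟨k, k'⟩)
    · exact Or.inl (h.trans k)
    · exact Or.inl (k ▸ h)
    · exact Or.inl (h ▸ k)
    · exact Or.inr ⟨h.trans k, h'.trans k'⟩
  trichotomous a b := by
    intro h h'
    rcases lt_trichotomy a b with _ | _ | _ <;> grind

section SwapMarket

variable {V : Type*} [Fintype V] [LinearOrder V] (σ : V → V) (o : V) (U : Finset V)

/-- The rank of `w` for the man `a` of `swapMarket`. -/
def swapManRank (a w : V) : ℕ :=
  if w = a then 0 else if w = σ a then 1 else 2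

/-- The rank of `b` for the woman `w` of `swapMarket`. -/
def swapWomanRank (w b : V) : ℕ :=
  if b = σ w then 0 else if (w ∈ U ∧ b = o) ∨ (w ∉ U ∧ b = w) then 1 else 2

/-- A market on `V` in which each man `a` likes the woman `a` best and the woman `σ a` second, and
each woman `w` likes the man `σ w` best; the second choice of `w` is the man `o` if `w ∈ U`, and the
man `w` otherwise. -/
def swapMarket : Market V V where
  card_eq := rfl
  man a w w' := swapManRank σ a w < swapManRank σ a w' ∨
    swapManRank σ a w = swapManRank σ a w' ∧ w < w'
  woman w b b' := swapWomanRank σ o U w b < swapWomanRank σ o U w b' ∨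
    swapWomanRank σ o U w b = swapWomanRank σ o U w b' ∧ b < b'
  man_order a := isStrictTotalOrder_of_rank (swapManRank σ a)
  woman_order w := isStrictTotalOrder_of_rank (swapWomanRank σ o U w)

variable {σ o U}

theorem swapMarket_man_self_right (a w : V) : ¬ (swapMarket σ o U).man a w a := by
  simp only [swapMarket, swapManRank]
  grind

theorem swapMarket_man_right {a w : V} (h : (swapMarket σ o U).man a w (σ a)) : w = a := by
  simp only [swapMarket, swapManRank] at h
  grind

theorem swapMarket_woman_left {w b : V} (h : b ≠ σ w) : (swapMarket σ o U).woman w (σ w) b := by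
  simp only [swapMarket, swapWomanRank]
  grind

theorem swapMarket_woman_self {w : V} (hw : w ∉ U) (hwo : w ≠ o) (ho : o ≠ σ w) :
    (swapMarket σ o U).woman w w o := by
  simp only [swapMarket, swapWomanRank]
  grind

theorem swapMarket_woman_accomplice {w b : V} (hw : w ∈ U) (hb : b ≠ σ w) (hbo : b ≠ o) :
    ¬ (swapMarket σ o U).woman w b o := by
  simp only [swapMarket, swapWomanRank]
  grind

theorem swapMarket_stable_id : (swapMarket σ o U).Stable id :=
  ⟨Function.bijective_id, fun a b h => absurd h (swapMarket_man_self_right a b)⟩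

theorem swapMarket_DA (a : V) : (swapMarket σ o U).DA a = a :=
  (swapMarket_stable_id.DA_weakly_better a).resolve_left (swapMarket_man_self_right a _)

/-- Swapping the partners in some of the pairs gives a stable matching. -/
theorem swapMarket_stable_swap (hσ : Function.Involutive σ) (T : V → Prop) [DecidablePred T]
    (hT : ∀ a, T (σ a) ↔ T a) :
    (swapMarket σ o U).Stable fun a => if T a then σ a else a := by
  have hinv : Function.Involutive fun a => if T a then σ a else a := by
    intro a
    by_cases h : T a <;> simp [h, hT, hσ a]
  refine ⟨hinv.bijective, fun a b h => ?_⟩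
  by_cases ha : T a
  · simp only [ha, if_true] at h
    have hb := swapMarket_man_right h
    have hba : b = σ a := by
      have := hinv b
      simp only [hb, ha, if_true] at this
      exact this.symm
    simp only [hb]
    subst hba
    refine swapMarket_woman_left fun he => ?_
    simp only [hT, ha, if_true, hσ a] at h
    rw [← he] at h
    exact swapMarket_man_self_right _ _ h
  · simp only [ha, if_false] at h
    exact absurd h (swapMarket_man_self_right _ _)

/-- A woman of `U` puts `o` ahead of everyone but `σ u`, so her constraint forces her pair to swap.
A woman `w ≠ o` outside `U` prefers both `w` and `σ w` to `o`, so her constraint is vacuous here. -/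
theorem swapMarket_constrainedStable (hσ : Function.Involutive σ) (ho : σ o = o) (T : V → Prop)
    [DecidablePred T] (hT : ∀ a, T (σ a) ↔ T a) (X : Finset V)
    (hX : ∀ u ∈ X, u ∈ U → T u) :
    (swapMarket σ o U).ConstrainedStable o X fun a => if T a then σ a else a := by
  refine ⟨swapMarket_stable_swap hσ T hT, ?_, fun b hb hbX => ?_⟩
  · simp [ho, swapMarket_DA]
  · by_cases h : T b
    · simp only [h, if_true]
      have := swapMarket_woman_left (σ := σ) (o := o) (U := U) (w := σ b) (b := o)
        (by rw [hσ b]; exact hb.symm)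
      rwa [hσ b] at this
    · simp only [h, if_false] at hbX ⊢
      refine swapMarket_woman_self (fun hbU => h (hX b hbX hbU)) hb fun he => hb ?_
      rw [← hσ b, ← he, ho]

/-- The full swap is stable after the push-up, so each man `a ≠ o` gets `a` or `σ a`. If `o` took
`u`, man `u` would need `σ u`, leaving nobody for man `σ u`. -/
theorem swapMarket_mem_noRegretSet (hσ : Function.Involutive σ) (ho : σ o = o)
    (hU : ∀ u ∈ U, σ u ∉ U) {u : V} (hu : u ∈ U) :
    u ∈ (swapMarket σ o U).noRegretSet o := by
  rw [Market.mem_noRegretSet]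
  set P := swapMarket σ o U with hP
  have huo : u ≠ o := by
    rintro rfl
    exact hU u hu (ho.symm ▸ hu)
  have hσuo : σ u ≠ o := fun h => huo (by rw [← hσ u, h, ho])
  have hs := (swapMarket_constrainedStable (U := U) hσ ho (fun _ => True) (fun _ => Iff.rfl) {u}
    (fun _ _ _ => trivial)).stable_pushUp
  simp only [if_true] at hs
  have hinj := (P.pushUp o {u}).DA_bijective.1
  have hweak : ∀ a, a ≠ o → (P.pushUp o {u}).DA a = a ∨ (P.pushUp o {u}).DA a = σ a := by
    intro a ha
    have h := hs.DA_weakly_better a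
    rw [Market.pushUp_man_of_ne _ ha] at h
    exact h.imp_left swapMarket_man_right
  have h := hs.DA_weakly_better o
  rw [Market.pushUp_man_self, ho] at h
  rcases h with h | h
  swap
  · exact Or.inr (h.trans (swapMarket_DA o).symm)
  have h' := (P.pushUpList_partner_right o {u} ((P.pushUp o {u}).DA o)).1
    (by rw [hP, swapMarket_DA]; exact h)
  rcases h'.2 with h' | h'
  · exact Or.inl h'
  rw [Finset.mem_singleton] at h'
  have hu' := (hweak u huo).resolve_left fun he => huo (hinj (he.trans h'.symm))
  rcases hweak (σ u) hσuo with h1 | h1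
  · exact absurd (hinj (h1.trans hu'.symm)) fun he => hU u hu (he.symm ▸ hu)
  · rw [hσ u] at h1
    exact absurd (hinj (h1.trans h'.symm)) hσuo

theorem swapMarket_subset (hσ : Function.Involutive σ) (ho : σ o = o)
    (hU : ∀ u ∈ U, σ u ∉ U) {Z : Finset V} (hZ : Z ⊆ (swapMarket σ o U).noRegretSet o)
    (h : ((swapMarket σ o U).pushUp o Z).DA =
      ((swapMarket σ o U).pushUp o ((swapMarket σ o U).noRegretSet o)).DA) : U ⊆ Z := by
  intro u hu
  by_contra huZ
  have hc := (Market.noRegret_of_subset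
    (Finset.Subset.refl ((swapMarket σ o U).noRegretSet o))).constrainedStable
  rw [← h] at hc
  have huo : u ≠ o := by
    rintro rfl
    exact hU u hu (ho.symm ▸ hu)
  -- Swap every pair except that of `u`. As `u ∉ Z` this meets the constraints, so by optimality man
  -- `u` keeps woman `u`; but she prefers `o` to him, against the constraint for the whole no-regret
  -- set.
  have hf := swapMarket_constrainedStable (U := U) hσ ho (fun a => a ≠ u ∧ a ≠ σ u)
    (fun a => by
      have h : σ a = u ↔ a = σ u := hσ.eq_iff
      rw [hσ.injective.ne_iff, and_comm, ne_eq (σ a), h])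
    Z (fun x hx hxU => ⟨fun e => huZ (e ▸ hx), fun e => hU u hu (e ▸ hxU)⟩)
  have hDA : ((swapMarket σ o U).pushUp o Z).DA u = u := by
    have := hf.DA_pushUp_weakly_better hZ u
    simp only [ne_eq, not_true_eq_false, false_and, if_false] at this
    exact this.resolve_left (swapMarket_man_self_right _ _)
  have h2 := hc.2.2 u huo
    (by rw [hDA]; exact swapMarket_mem_noRegretSet hσ ho hU hu)
  rw [hDA] at h2
  exact swapMarket_woman_accomplice hu (fun e => hU u hu (by rwa [← e])) huo h2

end SwapMarket

/-- The involution that swaps `2 * i + 1` and `2 * i + 2` whenever both are below `n`. -/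
def pairSwap (n : ℕ) (a : Fin n) : Fin n :=
  if h : a.1 % 2 = 1 ∧ a.1 + 1 < n then ⟨a.1 + 1, h.2⟩
  -- Truncated subtraction makes `0`, the later accomplice, a fixed point. For even `n` the last
  -- index `n - 1` has no mate and is fixed by the final branch.
  else if a.1 % 2 = 0 then ⟨a.1 - 1, by omega⟩ else a

theorem pairSwap_val (n : ℕ) (a : Fin n) : (pairSwap n a).1 =
    if a.1 % 2 = 1 ∧ a.1 + 1 < n then a.1 + 1 else if a.1 % 2 = 0 then a.1 - 1 else a.1 := by
  unfold pairSwap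
  split_ifs <;> rfl

theorem pairSwap_involutive (n : ℕ) : Function.Involutive (pairSwap n) := by
  intro a
  ext
  have ha := a.2
  have h := pairSwap_val n a
  rw [pairSwap_val]
  split_ifs at h ⊢ <;> omega

theorem exists_market_le_card (n : ℕ) (hn : 1 ≤ n) :
    ∃ (P : Market (Fin n) (Fin n)) (m : Fin n), ∀ Y, P.IsMinimumNoRegretPushUpSet m Y →
      n ≤ 2 * Y.card + 2 := by
  -- One woman, the odd index, from each of the `(n - 1) / 2` swapped pairs.
  let U : Finset (Fin n) := Finset.univ.image fun i : Fin ((n - 1) / 2) => ⟨2 * i.1 + 1, by omega⟩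
  have hcard : U.card = (n - 1) / 2 := by
    rw [Finset.card_image_of_injective, Finset.card_univ, Fintype.card_fin]
    intro i j h
    have := congrArg Fin.val h
    ext
    dsimp only at this
    omega
  let o : Fin n := ⟨0, hn⟩
  refine ⟨swapMarket (pairSwap n) o U, o, fun Y hY => ?_⟩
  have hsub := swapMarket_subset (pairSwap_involutive n) (by ext; simp [pairSwap, o]) ?_
    hY.1 hY.2.1
  · have := Finset.card_le_card hsub
    omega
  · intro u hu hu'
    simp only [U, Finset.mem_image, Finset.mem_univ, true_and] at hu hu'
    obtain ⟨i, rfl⟩ := hu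
    obtain ⟨j, hj⟩ := hu'
    have h := congrArg Fin.val hj
    have hi : (2 * i.1 + 1) % 2 = 1 ∧ 2 * i.1 + 1 + 1 < n := by omega
    simp only [pairSwap, hi, and_self, dite_true] at h
    omega

/-! ### Passage to the floor. -/

theorem mainTheorem6 (n : ℕ) (hn : 1 ≤ n) :
    (∀ (M : Type*) (W : Type*) [Fintype M] [Fintype W],
      Fintype.card M = n → Fintype.card W = n →
        ∀ (P : Market M W) (m : M) (Y : Finset W),
          P.IsMinimumNoRegretPushUpSet m Y → Y.card ≤ ⌊((n : ℝ) - 1) / 2⌋₊) ∧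
    (∃ (P : Market (Fin n) (Fin n)) (m : Fin n) (Y : Finset (Fin n)),
      P.IsMinimumNoRegretPushUpSet m Y ∧ Y.card = ⌊((n : ℝ) - 1) / 2⌋₊) := by
  have hle : ∀ k : ℕ, 2 * k < n → k ≤ ⌊((n : ℝ) - 1) / 2⌋₊ := by
    intro k hk
    apply Nat.le_floor
    have : ((2 * k + 1 : ℕ) : ℝ) ≤ n := by exact_mod_cast hk
    push_cast at this
    linarith
  constructor
  · rintro M W _ _ rfl - P m Y hY
    exact hle _ hY.two_mul_card_lt
  · obtain ⟨P, m, h⟩ := exists_market_le_card n hn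
    obtain ⟨Y, hY⟩ := P.exists_isMinimumNoRegretPushUpSet m
    refine ⟨P, m, Y, hY, le_antisymm (hle _ ?_) (Nat.lt_succ_iff.1 ?_)⟩
    · simpa using hY.two_mul_card_lt
    · rw [Nat.floor_lt' (Nat.succ_ne_zero _)]
      have : ((n : ℕ) : ℝ) ≤ (2 * Y.card + 2 : ℕ) := by exact_mod_cast h Y hY
      push_cast at this ⊢
      linarith
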